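/- Setting. Let $p\ge 2$ be an even integer, $k\ge 0$ an integer, and let $\|\xi\|=(\xi^{\mathsf T}H\xi)^{1/2}$ on $\mathbb R^{n_0}$ with $H\succ0$. Let $h=(h_1,\dots,h_{m_1})$ be a tuple of real polynomials in $\xi=(\xi_1,\dots,\xi_{n_0})$ such that $\Xi=\{\xi\in\mathbb R^{n_0}:h_1(\xi)\ge0,\dots,h_{m_1}(\xi)\ge0\}$ has nonempty interior, and let $X\subseteq\mathbb R^{n_1}$ be bounded, $f:X\to\mathbb R$ a function, and $F$ a real polynomial in $(x,\xi)\in\mathbb R^{n_1}\times\mathbb R^{n_0}$. Put $F_x=F(x,\cdot)$ and let $\deg(F_x)$ denote the largest degree of $F_x$ over $x\in X$ (the degree of $F_x$ for generic $x$). Given samples $\hat\xi^{(1)},\dots,\hat\xi^{(N)}\in\Xi$, $N\ge1$, let $Q_p^{(i)}(\xi)=\|\xi-\hat\xi^{(i)}\|^p$. For $t\ge0$ let $\Sigma[\xi]_t$ be the set of sums of squares of polynomials that have degree at most $t$ (only $0$ if $t<0$), let $\mathscr Q[h]_t=\Sigma[\xi]_t+\sum_j h_j\,\Sigma[\xi]_{t-\deg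 h_j}$, and let $\bar{\mathscr S}[h]_t$ be the set of real sequences $y=(y_\alpha)_{|\alpha|\le t}$ with $y_0=1$ and $\langle q,y\rangle:=\sum_\alpha q_\alpha y_\alpha\ge0$ for all $q\in\mathscr Q[h]_t$. For $\rho>0$ define $$v_p(x;\rho)=\sup\Big\{\tfrac1N\sum_{i=1}^N\int F_x\,d\mu^{(i)}:\ \mu^{(i)}\text{ Borel probability measures on }\Xi,\ \tfrac1N\sum_{i=1}^N\int Q_p^{(i)}\,d\mu^{(i)}\le\rho\Big\},$$ $$v_{p,k}(x;\rho)=\inf_{\lambda\ge0}\Big\{\lambda\rho+\tfrac1N\sum_{i=1}^N\ \sup_{y\in\bar{\mathscr S}[h]_{2k}}\langle F_x-\lambda Q_p^{(i)},y\rangle\Big\}.$$ Theorem. Assume $k\ge d_1:=\max\{\lceil\deg(F_x)/2\rceil,\lceil\deg(h)/2\rceil,p/2\}$, where $\deg(h)=\max_j\deg h_j$, and that either (i) $p\ge\deg(F_x)$; or (ii) there are $R>0$ and $k_1\in\mathbb N$ with $R-\|\xi\|_2^2\in\mathscr Q[h]_{2k_1+2}$ and $k\ge\deg(F_x)-p/2+k_1$.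 Let $K\subseteq\Xi$ be bounded. Then there are constants $C\ge0$ and $r_0>0$, independent of $x\in X$, of $N$ and of the choice of the samples in $K$, such that for all $N\ge1$, all samples $\hat\xi^{(1)},\dots,\hat\xi^{(N)}\in K$ and all $0<r\le r_0$: (a) for every $x\in X$ the values $v_p(x;r^p)$ and $v_{p,k}(x;r^p)$ are finite and $$0\le v_{p,k}(x;r^p)-v_p(x;r^p)\le C\,r;$$ (b) every $\bar x\in X$ that minimizes $f(x)+v_{p,k}(x;r^p)$ over $X$ (an optimal decision of the moment relaxation) is $Cr$-optimal for the empirical stochastic optimization problem: $$f(\bar x)+\tfrac1N\sum_{i=1}^NF(\bar x,\hat\xi^{(i)})\le f(x)+\tfrac1N\sum_{i=1}^NF(x,\hat\xi^{(i)})+C\,r\qquad\text{for all }x\in X.$$ The dependence of $C$ on $n_0$ is polynomial in the following sense: one can take $C=P(n_0)\cdot C_1$, where $C_1$ is the supremum over $x\in X$ and $\zeta\in K$ of the largest absolute value of a coefficient of $F(x,\cdot+\zeta)$, and the univariate real polynomial $P$, as well as $r_0$, depends only on $p$, $k$, a positive lower bound $\theta$ for the eigenvalues of $H$, and (in case (ii))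 $R$ and $k_1$. -/

import Mathlib

open MeasureTheory

noncomputable section

namespace MomentDRO

/-- A polynomial in the indeterminates `ξ₁, …, ξₙ`. -/
abbrev Poly (n : ℕ) := MvPolynomial (Fin n) ℝ

/-- The semialgebraic set `Ξ = {ξ : h₁(ξ) ≥ 0, …, hₘ(ξ) ≥ 0}`. -/
def feasibleSet {n m : ℕ} (h : Fin m → Poly n) : Set (Fin n → ℝ) :=
  {ξ | ∀ j, 0 ≤ MvPolynomial.eval ξ (h j)}

/-- `deg(h)`, the highest degree in the tuple `h`. -/
def tupleDegree {n m : ℕ} (h : Fin m → Poly n) : ℕ :=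
  Finset.univ.sup fun j => (h j).totalDegree

/-- The instantiation `F_x = F(x, ·)` of a polynomial `F(x, ξ)`, as a polynomial in `ξ`. -/
def slice {n₁ n₀ : ℕ} (F : MvPolynomial (Fin n₁ ⊕ Fin n₀) ℝ) (x : Fin n₁ → ℝ) : Poly n₀ :=
  MvPolynomial.aeval (Sum.elim (fun j => MvPolynomial.C (x j)) MvPolynomial.X) F

/-- `deg(F_x)`: the largest degree of `F_x` over `x ∈ X`. It is attained on a nonempty relatively
Zariski open subset of `X` (where some coefficient of top degree does not vanish), so it is the
degree of `F_x` at a generic `x`. The set is bounded by the degree of `F`. -/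
def sliceDegree {n₁ n₀ : ℕ} (F : MvPolynomial (Fin n₁ ⊕ Fin n₀) ℝ) (X : Set (Fin n₁ → ℝ)) : ℕ :=
  sSup {d | ∃ x ∈ X, d = (slice F x).totalDegree}

/-- The translated polynomial `q(· + ζ)`. -/
def translate {n : ℕ} (q : Poly n) (ζ : Fin n → ℝ) : Poly n :=
  MvPolynomial.aeval (fun j => MvPolynomial.X j + MvPolynomial.C (ζ j)) q

/-- The supremum, over `x ∈ X` and `ζ ∈ K`, of the largest absolute value of a coefficient of
`F(x, · + ζ)`; finite for bounded `X` and `K`. -/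
def coeffBound {n₁ n₀ : ℕ} (F : MvPolynomial (Fin n₁ ⊕ Fin n₀) ℝ)
    (X : Set (Fin n₁ → ℝ)) (K : Set (Fin n₀ → ℝ)) : ℝ :=
  sSup {c | ∃ x ∈ X, ∃ ζ ∈ K, ∃ α, c = |MvPolynomial.coeff α (translate (slice F x) ζ)|}

/-- The polynomial `Q_p(ξ) = ‖ξ - ζ‖^p`, where `‖ξ‖² = ξᵀ H ξ` and `p` is even. -/
def distPoly {n : ℕ} (H : Matrix (Fin n) (Fin n) ℝ) (p : ℕ) (ζ : Fin n → ℝ) : Poly n :=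
  (∑ a, ∑ b, MvPolynomial.C (H a b) * (MvPolynomial.X a - MvPolynomial.C (ζ a)) *
    (MvPolynomial.X b - MvPolynomial.C (ζ b))) ^ (p / 2)

/-- The polynomial `R - ‖ξ‖₂²` (standard Euclidean norm). -/
def ballPoly (n : ℕ) (R : ℝ) : Poly n :=
  MvPolynomial.C R - ∑ a, MvPolynomial.X a ^ 2

/-- The degree-`t` truncated quadratic module
`Σ[ξ]_t + h₁ Σ[ξ]_{t - deg h₁} + ⋯ + hₘ Σ[ξ]_{t - deg hₘ}`; a truncation of negative degree
contains only `0`. -/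
def quadModule {n m : ℕ} (h : Fin m → Poly n) (t : ℕ) : Set (Poly n) :=
  {q | ∃ (σ₀ : Poly n) (σ : Fin m → Poly n),
    (IsSumSq σ₀ ∧ σ₀.totalDegree ≤ t) ∧
    (∀ j, IsSumSq (σ j) ∧ (σ j = 0 ∨ (h j).totalDegree + (σ j).totalDegree ≤ t)) ∧
    q = σ₀ + ∑ j, h j * σ j}

/-- The pairing `⟨q, y⟩ = ∑_α q_α y_α`. -/
def pairing {n : ℕ} (q : Poly n) (y : (Fin n →₀ ℕ) → ℝ) : ℝ :=
  ∑ α ∈ q.support, MvPolynomial.coeff α q * y α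

/-- The normalized truncated pseudo-moment sequences of degree `t` associated with `h`: the
sequences `(y_α)_{|α| ≤ t}`, here extended by `0` to all exponents, with `y₀ = 1` that lie in the
dual cone of the degree-`t` truncated quadratic module of `h`. -/
def normalizedTms {n m : ℕ} (h : Fin m → Poly n) (t : ℕ) : Set ((Fin n →₀ ℕ) → ℝ) :=
  {y | (∀ α, t < α.degree → y α = 0) ∧ y 0 = 1 ∧ ∀ q ∈ quadModule h t, 0 ≤ pairing q y}

/-- The lowest relaxation order `d₁ = max {⌈deg(F_x)/2⌉, ⌈deg(h)/2⌉, p/2}`. -/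
def lowestOrder {n₁ n₀ m : ℕ} (F : MvPolynomial (Fin n₁ ⊕ Fin n₀) ℝ) (X : Set (Fin n₁ → ℝ))
    (h : Fin m → Poly n₀) (p : ℕ) : ℕ :=
  max (max ((sliceDegree F X + 1) / 2) ((tupleDegree h + 1) / 2)) (p / 2)

/-- The empirical mean `(1/N) ∑ᵢ F(x, ξ̂⁽ⁱ⁾)`. -/
def empiricalMean {n₁ n₀ N : ℕ} (F : MvPolynomial (Fin n₁ ⊕ Fin n₀) ℝ)
    (ξhat : Fin N → Fin n₀ → ℝ) (x : Fin n₁ → ℝ) : ℝ :=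
  (N : ℝ)⁻¹ * ∑ i, MvPolynomial.eval (ξhat i) (slice F x)

/-- The worst-case mean cost `v_p(x; ρ)`: the supremum of `(1/N) ∑ᵢ ∫ F_x dμ⁽ⁱ⁾` over Borel
probability measures `μ⁽¹⁾, …, μ⁽ᴺ⁾` on `Ξ` with `(1/N) ∑ᵢ ∫ ‖ξ - ξ̂⁽ⁱ⁾‖^p dμ⁽ⁱ⁾ ≤ ρ`
(all the integrals being finite). -/
def worstCaseMean {n₁ n₀ m N : ℕ} (H : Matrix (Fin n₀) (Fin n₀) ℝ) (p : ℕ)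
    (h : Fin m → Poly n₀) (F : MvPolynomial (Fin n₁ ⊕ Fin n₀) ℝ)
    (ξhat : Fin N → Fin n₀ → ℝ) (x : Fin n₁ → ℝ) (ρ : ℝ) : EReal :=
  ⨆ μ ∈ {μ : Fin N → Measure (Fin n₀ → ℝ) |
      (∀ i, IsProbabilityMeasure (μ i) ∧ (∀ᵐ ξ ∂(μ i), ξ ∈ feasibleSet h) ∧
        Integrable (fun ξ => MvPolynomial.eval ξ (distPoly H p (ξhat i))) (μ i) ∧
        Integrable (fun ξ => MvPolynomial.eval ξ (slice F x)) (μ i)) ∧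
      (N : ℝ)⁻¹ * ∑ i, ∫ ξ, MvPolynomial.eval ξ (distPoly H p (ξhat i)) ∂(μ i) ≤ ρ},
    (((N : ℝ)⁻¹ * ∑ i, ∫ ξ, MvPolynomial.eval ξ (slice F x) ∂(μ i) : ℝ) : EReal)

/-- The order-`k` moment relaxation `v_{p,k}(x; ρ)`: the infimum over `l ≥ 0` of
`l ρ + (1/N) ∑ᵢ sup_y ⟨F_x - l Q_p⁽ⁱ⁾, y⟩`, with `y` ranging over the normalized truncated
pseudo-moment sequences of degree `2k`. -/
def relaxedMean {n₁ n₀ m N : ℕ} (H : Matrix (Fin n₀) (Fin n₀) ℝ) (p k : ℕ)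
    (h : Fin m → Poly n₀) (F : MvPolynomial (Fin n₁ ⊕ Fin n₀) ℝ)
    (ξhat : Fin N → Fin n₀ → ℝ) (x : Fin n₁ → ℝ) (ρ : ℝ) : EReal :=
  ⨅ l ∈ Set.Ici (0 : ℝ),
    ((l * ρ : ℝ) : EReal) + (((N : ℝ)⁻¹ : ℝ) : EReal) *
      ∑ i, ⨆ y ∈ normalizedTms h (2 * k),
        ((pairing (slice F x - MvPolynomial.C l * distPoly H p (ξhat i)) y : ℝ) : EReal)

end MomentDRO

end

/-! Everything is squeezed around the empirical mean `E(x)`: `E ≤ v_p ≤ v_{p,k} ≤ E + C r`. The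
Dirac measures at the samples give the first inequality, weak duality the second. The gap in (a) is
then at most `C r`, and (b) follows by using the lower bound at the minimizer and the upper bound at
its competitor.

For the upper bound a single multiplier of size `r^(1-p)` is inserted and each sample `ζ` is treated
separately. Centering a pseudo-moment sequence at `ζ` gives a functional `Λ` with `Λ 1 = 1` that is
nonnegative on sums of squares of degree at most `2k`. Put `s = p/2` and `T = Λ(‖ξ‖₂^(2s))`. Every
nonconstant moment that occurs in `F_x` is at most a constant times `r + r^(1-p) T`
(`abs_map_monomial_le`), while the constant term of the centered `F_x` is `F_x(ζ)`. The penalty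
satisfies `Λ((ξᵀHξ)^s) ≥ θ^s T`, so the multiplier can cancel the unknown `T` and an error of order
`r` remains (`pairing_slice_sub_le`).

The moment bounds rest on explicit sum-of-squares certificates whose constants do not involve the
dimension; the dimension enters only through the number of monomials, at most `(n₀ + 1)^(2k)`.
Moments of degree above `p` occur only in case (ii), where the ball constraint gives `Λ(‖ξ‖₂^(2j+2))
≤ 4R Λ(‖ξ‖₂^(2j))` (`centeredHom_sqNorm_pow_succ_le`). -/

namespace MomentDRO

/-! ### Sums of squares of bounded degree -/

/-- Sums of squares of degree at most `t`. -/
def IsSos {n : ℕ} (t : ℕ) (q : Poly n) : Prop := IsSumSq q ∧ q.totalDegree ≤ t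

section Degree

variable {n : ℕ}

lemma totalDegree_add_le_of {q₁ q₂ : Poly n} {t : ℕ} (h₁ : q₁.totalDegree ≤ t)
    (h₂ : q₂.totalDegree ≤ t) : (q₁ + q₂).totalDegree ≤ t :=
  (MvPolynomial.totalDegree_add _ _).trans (max_le h₁ h₂)

lemma totalDegree_sub_le_of {q₁ q₂ : Poly n} {t : ℕ} (h₁ : q₁.totalDegree ≤ t)
    (h₂ : q₂.totalDegree ≤ t) : (q₁ - q₂).totalDegree ≤ t :=
  (MvPolynomial.totalDegree_sub _ _).trans (max_le h₁ h₂)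

lemma totalDegree_mul_le_of {q₁ q₂ : Poly n} {a b t : ℕ} (h₁ : q₁.totalDegree ≤ a)
    (h₂ : q₂.totalDegree ≤ b) (h : a + b ≤ t) : (q₁ * q₂).totalDegree ≤ t :=
  (MvPolynomial.totalDegree_mul _ _).trans (by omega)

lemma totalDegree_C_mul_le_of {q : Poly n} {t : ℕ} (c : ℝ) (h : q.totalDegree ≤ t) :
    (MvPolynomial.C c * q).totalDegree ≤ t :=
  totalDegree_mul_le_of (MvPolynomial.totalDegree_C c).le h (by omega)

lemma totalDegree_sum_le_of {ι : Type*} {I : Finset ι} {q : ι → Poly n} {t : ℕ}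
    (h : ∀ i ∈ I, (q i).totalDegree ≤ t) : (∑ i ∈ I, q i).totalDegree ≤ t :=
  MvPolynomial.totalDegree_finsetSum_le h

lemma totalDegree_pow_le_of {q : Poly n} {a : ℕ} (h : q.totalDegree ≤ a) (b : ℕ) :
    (q ^ b).totalDegree ≤ b * a :=
  (MvPolynomial.totalDegree_pow _ _).trans (Nat.mul_le_mul_left _ h)

lemma totalDegree_monomial_le_degree (α : Fin n →₀ ℕ) (c : ℝ) :
    (MvPolynomial.monomial α c : Poly n).totalDegree ≤ α.degree := by
  rw [Finsupp.degree_apply]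
  exact MvPolynomial.totalDegree_monomial_le α c

/-- The translation `q ↦ q(· + ζ)` as an algebra homomorphism. -/
noncomputable def translateHom (ζ : Fin n → ℝ) : Poly n →ₐ[ℝ] Poly n :=
  MvPolynomial.aeval fun j => MvPolynomial.X j + MvPolynomial.C (ζ j)

lemma translate_eq (q : Poly n) (ζ : Fin n → ℝ) : translate q ζ = translateHom ζ q := rfl

@[simp] lemma translateHom_X (ζ : Fin n → ℝ) (j : Fin n) :
    translateHom ζ (MvPolynomial.X j) = MvPolynomial.X j + MvPolynomial.C (ζ j) := by
  simp [translateHom]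

@[simp] lemma translateHom_C (ζ : Fin n → ℝ) (c : ℝ) :
    translateHom ζ (MvPolynomial.C c) = MvPolynomial.C c := by
  simp [translateHom, MvPolynomial.algebraMap_eq]

lemma translateHom_neg_translateHom (ζ : Fin n → ℝ) (q : Poly n) :
    translateHom (-ζ) (translateHom ζ q) = q := by
  have : (translateHom (-ζ)).comp (translateHom ζ) = AlgHom.id ℝ (Poly n) := by
    ext j : 1
    simp
  exact DFunLike.congr_fun this q

lemma totalDegree_translateHom_le (ζ : Fin n → ℝ) (q : Poly n) :
    (translateHom ζ q).totalDegree ≤ q.totalDegree := by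
  rw [translateHom, MvPolynomial.aeval_def, MvPolynomial.eval₂_eq]
  refine totalDegree_sum_le_of fun α hα => ?_
  refine (totalDegree_C_mul_le_of _ ?_).trans (MvPolynomial.le_totalDegree hα)
  refine (MvPolynomial.totalDegree_finsetProd _ _).trans (Finset.sum_le_sum fun i _ => ?_)
  refine (totalDegree_pow_le_of (a := 1) ?_ _).trans (by simp)
  exact totalDegree_add_le_of (MvPolynomial.totalDegree_X i).le (by simp)

lemma eval_eq_coeff_zero_translate (q : Poly n) (ζ : Fin n → ℝ) :
    MvPolynomial.eval ζ q = MvPolynomial.coeff 0 (translate q ζ) := by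
  rw [← MvPolynomial.constantCoeff_eq, translate_eq]
  have : (MvPolynomial.aeval ζ : Poly n →ₐ[ℝ] ℝ) =
      (MvPolynomial.aeval (0 : Fin n → ℝ)).comp (translateHom ζ) := by
    ext j
    simp [translateHom]
  have h := DFunLike.congr_fun this q
  simpa [MvPolynomial.aeval_zero, MvPolynomial.aeval_eq_eval] using h

end Degree

lemma IsSumSq.map_algHom {A B : Type*} [CommRing A] [CommRing B] [Algebra ℝ A] [Algebra ℝ B]
    (φ : A →ₐ[ℝ] B) {a : A} (ha : IsSumSq a) : IsSumSq (φ a) := by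
  induction ha with
  | zero => simp
  | sq_add a _ ih => simpa using IsSumSq.sq_add (φ a) ih

lemma IsSumSq.pow_nat {A : Type*} [CommRing A] {a : A} (ha : IsSumSq a) (b : ℕ) :
    IsSumSq (a ^ b) := by
  induction b with
  | zero => simp
  | succ b ih => rw [pow_succ]; exact ih.mul ha

lemma isSumSq_C {n : ℕ} {c : ℝ} (hc : 0 ≤ c) : IsSumSq (MvPolynomial.C c : Poly n) := by
  have : (MvPolynomial.C c : Poly n) = MvPolynomial.C (√c) * MvPolynomial.C (√c) := by
    rw [← map_mul, Real.mul_self_sqrt hc]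
  rw [this]
  exact IsSumSq.mul_self _

namespace IsSos

variable {n : ℕ} {q₁ q₂ : Poly n} {a b t : ℕ}

lemma mono (h : IsSos a q₁) (hab : a ≤ b) : IsSos b q₁ := ⟨h.1, h.2.trans hab⟩

lemma add (h₁ : IsSos t q₁) (h₂ : IsSos t q₂) : IsSos t (q₁ + q₂) :=
  ⟨h₁.1.add h₂.1, totalDegree_add_le_of h₁.2 h₂.2⟩

lemma mul (h₁ : IsSos a q₁) (h₂ : IsSos b q₂) (h : a + b ≤ t) : IsSos t (q₁ * q₂) :=
  ⟨h₁.1.mul h₂.1, totalDegree_mul_le_of h₁.2 h₂.2 h⟩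

lemma sum {ι : Type*} {I : Finset ι} {q : ι → Poly n} (h : ∀ i ∈ I, IsSos t (q i)) :
    IsSos t (∑ i ∈ I, q i) :=
  ⟨IsSumSq.sum fun i hi => (h i hi).1, totalDegree_sum_le_of fun i hi => (h i hi).2⟩

lemma mul_self (h : q₁.totalDegree ≤ a) : IsSos (2 * a) (q₁ * q₁) :=
  ⟨IsSumSq.mul_self _, totalDegree_mul_le_of h h (by omega)⟩

lemma pow (h : IsSos a q₁) (b : ℕ) : IsSos (b * a) (q₁ ^ b) :=
  ⟨IsSumSq.pow_nat h.1 b, totalDegree_pow_le_of h.2 b⟩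

lemma const {c : ℝ} (hc : 0 ≤ c) : IsSos t (MvPolynomial.C c : Poly n) :=
  ⟨isSumSq_C hc, by simp⟩

lemma C_mul {c : ℝ} (hc : 0 ≤ c) (h : IsSos t q₁) : IsSos t (MvPolynomial.C c * q₁) :=
  (const (t := 0) hc).mul h (by omega)

lemma translateHom (h : IsSos t q₁) (ζ : Fin n → ℝ) : IsSos t (translateHom ζ q₁) :=
  ⟨IsSumSq.map_algHom _ h.1, (totalDegree_translateHom_le ζ q₁).trans h.2⟩

/-- `(A + B)^s - A^s` is a sum of squares if `A` and `B` are. -/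
lemma add_pow_sub_pow (h₁ : IsSos a q₁) (h₂ : IsSos a q₂) (s : ℕ) :
    IsSos (s * a) ((q₁ + q₂) ^ s - q₁ ^ s) := by
  induction s with
  | zero => simpa using const (n := n) (t := 0) le_rfl
  | succ s ih =>
    have : (q₁ + q₂) ^ (s + 1) - q₁ ^ (s + 1) =
        ((q₁ + q₂) ^ s - q₁ ^ s) * (q₁ + q₂) + q₁ ^ s * q₂ := by ring
    rw [this]
    have e : s * a + a ≤ (s + 1) * a := by rw [Nat.succ_mul]
    exact (ih.mul (h₁.add h₂) e).add ((h₁.pow s).mul h₂ e)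

end IsSos

/-! ### The squared Euclidean norm -/

/-- The polynomial `‖ξ‖₂²`. -/
noncomputable def sqNorm (n : ℕ) : Poly n := ∑ a, MvPolynomial.X a ^ 2

section SqNorm

variable {n : ℕ}

lemma isSos_X_sq (a : Fin n) : IsSos 2 (MvPolynomial.X a ^ 2 : Poly n) := by
  rw [sq]
  exact IsSos.mul_self (a := 1) (MvPolynomial.totalDegree_X a).le

lemma isSos_sqNorm : IsSos 2 (sqNorm n) := IsSos.sum fun a _ => isSos_X_sq a

lemma isSos_sqNorm_pow (b : ℕ) : IsSos (2 * b) (sqNorm n ^ b) := by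
  rw [mul_comm]; exact isSos_sqNorm.pow b

lemma isSos_sqNorm_sub_X_sq (a : Fin n) : IsSos 2 (sqNorm n - MvPolynomial.X a ^ 2) := by
  rw [sqNorm, ← Finset.add_sum_erase _ _ (Finset.mem_univ a), add_sub_cancel_left]
  exact IsSos.sum fun a _ => isSos_X_sq a

/-- `‖ξ‖₂^{2|β|} - ξ^{2β}` is a sum of squares. -/
lemma isSos_sqNorm_pow_sub_monomial (β : Fin n →₀ ℕ) :
    IsSos (2 * β.degree) (sqNorm n ^ β.degree -
      MvPolynomial.monomial β 1 * MvPolynomial.monomial β 1) := by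
  obtain ⟨b, hb⟩ : ∃ b, β.degree = b := ⟨_, rfl⟩
  induction b generalizing β with
  | zero =>
    have : β = 0 := (Finsupp.degree_eq_zero_iff β).1 hb
    subst this
    simpa using IsSos.const (n := n) (t := 0) le_rfl
  | succ b ih =>
    -- One variable is peeled off, `β = γ + eᵢ`; each factor `‖ξ‖₂²` dominates the square of the
    -- removed variable with constant 1.
    obtain ⟨γ, hγ, hγd⟩ := Finsupp.exists_le_degree_eq β b (by omega)
    obtain ⟨δ, rfl⟩ := exists_add_of_le hγ
    have hδ : δ.degree = 1 := by simp only [map_add] at hb; omega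
    obtain ⟨i, rfl⟩ := (Finsupp.sum_eq_one_iff δ).1 hδ
    have e := ih γ hγd
    rw [hγd] at e
    rw [hb]
    have : sqNorm n ^ (b + 1) - MvPolynomial.monomial (γ + Finsupp.single i 1) 1 *
          MvPolynomial.monomial (γ + Finsupp.single i 1) 1 =
        (sqNorm n ^ b - MvPolynomial.monomial γ 1 * MvPolynomial.monomial γ 1) * sqNorm n +
        MvPolynomial.monomial γ 1 * MvPolynomial.monomial γ 1 *
          (sqNorm n - MvPolynomial.X i ^ 2) := by
      rw [MvPolynomial.monomial_add_single]
      ring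
    rw [this]
    refine (e.mul isSos_sqNorm (by omega)).add
      (IsSos.mul (IsSos.mul_self (totalDegree_monomial_le_degree γ 1))
        (isSos_sqNorm_sub_X_sq i) (by omega))

/-- `‖ξ‖₂^{2s} + ρ^s - ρ^{s-b} ‖ξ‖₂^{2b}` is a sum of squares. -/
lemma isSos_sqNorm_young {ρ : ℝ} (hρ : 0 ≤ ρ) {b s : ℕ} (hbs : b ≤ s) :
    IsSos (2 * s) (sqNorm n ^ s + MvPolynomial.C (ρ ^ s) -
      MvPolynomial.C (ρ ^ (s - b)) * sqNorm n ^ b) := by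
  obtain ⟨c, rfl⟩ := Nat.exists_eq_add_of_le hbs
  rw [Nat.add_sub_cancel_left]
  constructor
  · have hw := (isSos_sqNorm (n := n)).1
    have hC : IsSumSq (MvPolynomial.C ρ : Poly n) := isSumSq_C hρ
    have hg : ∀ d, IsSumSq (∑ i ∈ Finset.range d,
        sqNorm n ^ i * (MvPolynomial.C ρ : Poly n) ^ (d - 1 - i)) := fun d =>
      IsSumSq.sum fun i _ => (IsSumSq.pow_nat hw _).mul (IsSumSq.pow_nat hC _)
    -- Both differences of powers are `‖ξ‖₂² - ρ` times a geometric sum that is a sum of squares, so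
    -- their product is a sum of squares times `(‖ξ‖₂² - ρ)²`.
    have e : sqNorm n ^ (b + c) + MvPolynomial.C (ρ ^ (b + c)) -
        MvPolynomial.C (ρ ^ c) * sqNorm n ^ b =
        (sqNorm n ^ b - MvPolynomial.C ρ ^ b) * (sqNorm n ^ c - MvPolynomial.C ρ ^ c) +
          MvPolynomial.C ρ ^ b * sqNorm n ^ c := by
      simp only [map_pow]; ring
    rw [e, ← geom_sum₂_mul, ← geom_sum₂_mul, mul_mul_mul_comm]
    exact (((hg b).mul (hg c)).mul (IsSumSq.mul_self _)).add
      ((IsSumSq.pow_nat hC _).mul (IsSumSq.pow_nat hw _))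
  · refine totalDegree_sub_le_of (totalDegree_add_le_of (isSos_sqNorm_pow _).2
      ((MvPolynomial.totalDegree_C _).trans_le (Nat.zero_le _)))
      (totalDegree_C_mul_le_of _ ((isSos_sqNorm_pow b).2.trans (by omega)))

/-- The quadratic form `ξᵀ H ξ` as a polynomial. -/
noncomputable def quadForm (H : Matrix (Fin n) (Fin n) ℝ) : Poly n :=
  ∑ a, ∑ b, MvPolynomial.C (H a b) * MvPolynomial.X a * MvPolynomial.X b

/-- A positive semidefinite matrix is a sum of rank-one matrices `v vᵀ`, each contributing the
square of a linear form. -/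
lemma isSos_quadForm {H : Matrix (Fin n) (Fin n) ℝ} (hH : H.PosSemidef) :
    IsSos 2 (quadForm H) := by
  obtain ⟨m, v, rfl⟩ := Matrix.posSemidef_iff_eq_sum_vecMulVec.1 hH
  have : quadForm (∑ i, Matrix.vecMulVec (v i) (star (v i))) =
      ∑ i, (∑ a, MvPolynomial.C (v i a) * MvPolynomial.X a) *
        (∑ a, MvPolynomial.C (v i a) * MvPolynomial.X a) := by
    simp only [quadForm, Matrix.sum_apply, Matrix.vecMulVec_apply, star_trivial,
      map_sum, map_mul, Finset.sum_mul_sum]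
    rw [Finset.sum_comm (γ := Fin m)]
    refine Finset.sum_congr rfl fun a _ => ?_
    rw [Finset.sum_comm (γ := Fin m)]
    refine Finset.sum_congr rfl fun b _ => ?_
    simp only [Finset.sum_mul]
    exact Finset.sum_congr rfl fun i _ => by ring
  rw [this]
  refine IsSos.sum fun i _ => IsSos.mul_self (a := 1) (totalDegree_sum_le_of fun a _ => ?_)
  exact totalDegree_C_mul_le_of _ (MvPolynomial.totalDegree_X a).le

lemma quadForm_eq_add (H : Matrix (Fin n) (Fin n) ℝ) (θ : ℝ) :
    quadForm H = MvPolynomial.C θ * sqNorm n + quadForm (H - θ • 1) := by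
  simp only [quadForm, sqNorm, Matrix.sub_apply, Matrix.smul_apply, Matrix.one_apply, map_sub,
    sub_mul, Finset.sum_sub_distrib, smul_eq_mul, mul_ite, mul_one, mul_zero]
  simp [apply_ite MvPolynomial.C, ite_mul, Finset.mul_sum, sq, mul_assoc]

lemma distPoly_eq_translateHom (H : Matrix (Fin n) (Fin n) ℝ) (p : ℕ) (ζ : Fin n → ℝ) :
    distPoly H p ζ = translateHom (-ζ) (quadForm H ^ (p / 2)) := by
  simp [distPoly, quadForm, sub_eq_add_neg]

/-- If the eigenvalues of `H` are at least `θ`, then `(ξᵀ H ξ)^s - θ^s ‖ξ‖₂^{2s}` is a sum of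
squares. -/
lemma isSos_quadForm_pow_sub {H : Matrix (Fin n) (Fin n) ℝ} (hH : H.IsHermitian) {θ : ℝ}
    (hθ : 0 ≤ θ) (hHθ : ∀ v : Fin n → ℝ, θ * (v ⬝ᵥ v) ≤ v ⬝ᵥ H.mulVec v) (s : ℕ) :
    IsSos (2 * s) (quadForm H ^ s - MvPolynomial.C (θ ^ s) * sqNorm n ^ s) := by
  have h : (H - θ • (1 : Matrix (Fin n) (Fin n) ℝ)).PosSemidef := by
    refine Matrix.PosSemidef.of_dotProduct_mulVec_nonneg ?_ fun v => ?_
    · refine hH.sub ?_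
      simp [Matrix.IsHermitian]
    · have := hHθ v
      simp only [star_trivial, Matrix.sub_mulVec, Matrix.smul_mulVec, Matrix.one_mulVec,
        dotProduct_sub, dotProduct_smul, smul_eq_mul]
      linarith
  have := IsSos.add_pow_sub_pow (isSos_sqNorm.C_mul hθ) (isSos_quadForm h) s
  rwa [← quadForm_eq_add, mul_pow, ← map_pow, mul_comm s 2] at this

lemma totalDegree_distPoly_le (H : Matrix (Fin n) (Fin n) ℝ) {p : ℕ} (ζ : Fin n → ℝ) :
    (distPoly H p ζ).totalDegree ≤ 2 * (p / 2) := by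
  rw [distPoly_eq_translateHom]
  refine (totalDegree_translateHom_le _ _).trans ?_
  rw [mul_comm 2]
  refine totalDegree_pow_le_of (totalDegree_sum_le_of fun a _ => totalDegree_sum_le_of fun b _ => ?_) _
  exact totalDegree_mul_le_of (totalDegree_C_mul_le_of _ (MvPolynomial.totalDegree_X a).le)
    (MvPolynomial.totalDegree_X b).le (by omega)

end SqNorm

/-! ### Moment bounds for positive functionals -/

section Functional

variable {n t : ℕ} {Λ : Poly n →ₗ[ℝ] ℝ}

lemma map_C_mul (Λ : Poly n →ₗ[ℝ] ℝ) (c : ℝ) (q : Poly n) :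
    Λ (MvPolynomial.C c * q) = c * Λ q := by
  rw [← MvPolynomial.smul_eq_C_mul, map_smul, smul_eq_mul]

lemma map_monomial_sq_le (hΛ : ∀ q, IsSos t q → 0 ≤ Λ q) {β : Fin n →₀ ℕ}
    (hβ : 2 * β.degree ≤ t) :
    Λ (MvPolynomial.monomial β 1 * MvPolynomial.monomial β 1) ≤ Λ (sqNorm n ^ β.degree) := by
  have := hΛ _ ((isSos_sqNorm_pow_sub_monomial β).mono hβ)
  rw [map_sub] at this
  linarith

/-- Cauchy–Schwarz in its weighted arithmetic-geometric form: expand `Λ((c ξ^β ± d ξ^γ)²) ≥ 0`. The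
free weights let the scale `r` enter later without square roots. -/
lemma abs_map_monomial_add_le (hΛ : ∀ q, IsSos t q → 0 ≤ Λ q) {β γ : Fin n →₀ ℕ}
    (hβ : 2 * β.degree ≤ t) (hγ : 2 * γ.degree ≤ t) (c d : ℝ) :
    2 * (c * d) * |Λ (MvPolynomial.monomial (β + γ) 1)| ≤
      c ^ 2 * Λ (sqNorm n ^ β.degree) + d ^ 2 * Λ (sqNorm n ^ γ.degree) := by
  have h₁ := map_monomial_sq_le hΛ hβ
  have h₂ := map_monomial_sq_le hΛ hγ
  have key : ∀ e : ℝ, 0 ≤ c ^ 2 * Λ (MvPolynomial.monomial β 1 * MvPolynomial.monomial β 1) +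
      2 * (c * e) * Λ (MvPolynomial.monomial (β + γ) 1) +
      e ^ 2 * Λ (MvPolynomial.monomial γ 1 * MvPolynomial.monomial γ 1) := by
    intro e
    have hs : IsSos t ((MvPolynomial.C c * MvPolynomial.monomial β 1 +
        MvPolynomial.C e * MvPolynomial.monomial γ 1) *
        (MvPolynomial.C c * MvPolynomial.monomial β 1 +
        MvPolynomial.C e * MvPolynomial.monomial γ 1)) :=
      (IsSos.mul_self (a := t / 2) (totalDegree_add_le_of
        (totalDegree_C_mul_le_of _ ((totalDegree_monomial_le_degree β 1).trans (by omega)))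
        (totalDegree_C_mul_le_of _ ((totalDegree_monomial_le_degree γ 1).trans (by omega))))).mono
        (by omega)
    have := hΛ _ hs
    have e1 : (MvPolynomial.C c * MvPolynomial.monomial β 1 +
        MvPolynomial.C e * MvPolynomial.monomial γ 1) *
        (MvPolynomial.C c * MvPolynomial.monomial β 1 +
        MvPolynomial.C e * MvPolynomial.monomial γ 1) =
        MvPolynomial.C (c ^ 2) * (MvPolynomial.monomial β 1 * MvPolynomial.monomial β (1 : ℝ)) +
        MvPolynomial.C (2 * (c * e)) * MvPolynomial.monomial (β + γ) 1 +
        MvPolynomial.C (e ^ 2) * (MvPolynomial.monomial γ 1 * MvPolynomial.monomial γ 1) := by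
      have : (MvPolynomial.monomial (β + γ) 1 : Poly n) =
          MvPolynomial.monomial β 1 * MvPolynomial.monomial γ 1 := by
        simp [MvPolynomial.monomial_mul]
      rw [this]
      simp only [map_mul, map_pow, map_ofNat]
      ring
    rwa [e1, map_add, map_add, map_C_mul, map_C_mul, map_C_mul] at this
  have k₁ := key d
  have k₂ := key (-d)
  have l₁ := mul_le_mul_of_nonneg_left h₁ (sq_nonneg c)
  have l₂ := mul_le_mul_of_nonneg_left h₂ (sq_nonneg d)
  rcases abs_cases (Λ (MvPolynomial.monomial (β + γ) 1)) with ⟨h, _⟩ | ⟨h, _⟩ <;> rw [h] <;>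
    nlinarith

/-- Moments of degree at most `2s` at scale `r` are controlled by `1` and `Λ(‖ξ‖₂^{2s})`. -/
lemma abs_map_monomial_le_of_degree_le (hΛ : ∀ q, IsSos t q → 0 ≤ Λ q) (hΛ₁ : Λ 1 = 1) {s : ℕ}
    (hs : 2 * s ≤ t) {r : ℝ} (hr : 0 < r) {α : Fin n →₀ ℕ} (hα : α.degree ≤ 2 * s) :
    |Λ (MvPolynomial.monomial α 1)| ≤
      r ^ α.degree * (1 + Λ (sqNorm n ^ s) / r ^ (2 * s)) := by
  set A := 1 + Λ (sqNorm n ^ s) / r ^ (2 * s) with hA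
  -- The certificate `isSos_sqNorm_young` at `ρ = r²`.
  have hw : ∀ b ≤ s, Λ (sqNorm n ^ b) ≤ (r ^ b) ^ 2 * A := by
    intro b hb
    have h := hΛ _ ((isSos_sqNorm_young (n := n) (sq_nonneg r) hb).mono hs)
    rw [map_sub, map_add, map_C_mul, ← mul_one (MvPolynomial.C ((r ^ 2) ^ s)), map_C_mul, hΛ₁,
      mul_one] at h
    have e : Λ (sqNorm n ^ s) + (r ^ 2) ^ s = (r ^ 2) ^ (s - b) * ((r ^ b) ^ 2 * A) := by
      have e2 : (r ^ 2) ^ (s - b) * (r ^ b) ^ 2 = r ^ (2 * s) := by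
        rw [← pow_mul, ← pow_mul, ← pow_add]
        congr 1
        omega
      rw [← mul_assoc, e2, hA, ← pow_mul]
      field_simp
      ring
    rw [e] at h
    exact le_of_mul_le_mul_left (by linarith) (pow_pos (pow_pos hr 2) (s - b))
  -- Halving keeps both degrees at most `s`, within reach of `hw`. The crossed weights `r^|γ|`,
  -- `r^|β|` then give both squares the same power `r^(2|α|)`.
  obtain ⟨β, hβ, hβd⟩ := Finsupp.exists_le_degree_eq α (α.degree / 2) (by omega)
  obtain ⟨γ, rfl⟩ := exists_add_of_le hβ
  rw [map_add] at *
  have h := abs_map_monomial_add_le hΛ (β := β) (γ := γ) (by omega) (by omega)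
    (r ^ γ.degree) (r ^ β.degree)
  have h₁ := mul_le_mul_of_nonneg_left (hw β.degree (by omega)) (sq_nonneg (r ^ γ.degree))
  have h₂ := mul_le_mul_of_nonneg_left (hw γ.degree (by omega)) (sq_nonneg (r ^ β.degree))
  have hpos : 0 < 2 * (r ^ γ.degree * r ^ β.degree) := by positivity
  refine le_of_mul_le_mul_left ((h.trans (add_le_add h₁ h₂)).trans_eq ?_) hpos
  rw [pow_add]
  ring

/-- Bound for the moments of degree between `1` and `D` at scale `r`; if `D > 2s`, the growth of
the moments of `‖ξ‖₂²` has to be controlled. -/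
lemma abs_map_monomial_le (hΛ : ∀ q, IsSos t q → 0 ≤ Λ q) (hΛ₁ : Λ 1 = 1) {s D E : ℕ}
    (hs₁ : 1 ≤ s) (hs : 2 * s ≤ t) {r : ℝ} (hr : 0 < r) (hr₁ : r ≤ 1) {M : ℝ} (hM : 1 ≤ M)
    (hDE : D ≤ E)
    (hD : D ≤ 2 * s ∨ (2 * (D - s) ≤ t ∧
      ∀ j, j + 1 + s ≤ D → Λ (sqNorm n ^ (j + 1)) ≤ M * Λ (sqNorm n ^ j)))
    {α : Fin n →₀ ℕ} (hα : α.degree ≠ 0) (hαD : α.degree ≤ D) :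
    |Λ (MvPolynomial.monomial α 1)| ≤ M ^ E * (r + r / r ^ (2 * s) * Λ (sqNorm n ^ s)) := by
  have hT : 0 ≤ Λ (sqNorm n ^ s) := hΛ _ ((isSos_sqNorm_pow s).mono hs)
  have hME : 1 ≤ M ^ E := one_le_pow₀ hM
  rcases le_or_gt α.degree (2 * s) with h | h
  · refine (abs_map_monomial_le_of_degree_le hΛ hΛ₁ hs hr h).trans ?_
    have hle : r ^ α.degree ≤ r := pow_le_of_le_one hr.le hr₁ hα
    calc r ^ α.degree * (1 + Λ (sqNorm n ^ s) / r ^ (2 * s))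
        ≤ r * (1 + Λ (sqNorm n ^ s) / r ^ (2 * s)) := by gcongr
      _ = 1 * (r + r / r ^ (2 * s) * Λ (sqNorm n ^ s)) := by ring
      _ ≤ M ^ E * (r + r / r ^ (2 * s) * Λ (sqNorm n ^ s)) := by gcongr
  · obtain ⟨hDt, hgrow⟩ := hD.resolve_left (by omega)
    have hg : ∀ j, j + 2 * s ≤ D → Λ (sqNorm n ^ (s + j)) ≤ M ^ j * Λ (sqNorm n ^ s) := by
      intro j
      induction j with
      | zero => simp
      | succ j ih =>
        intro hj
        have h₁ := ih (by omega)
        have h₂ := hgrow (s + j) (by omega)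
        calc Λ (sqNorm n ^ (s + (j + 1))) ≤ M * Λ (sqNorm n ^ (s + j)) := h₂
          _ ≤ M * (M ^ j * Λ (sqNorm n ^ s)) := by gcongr
          _ = M ^ (j + 1) * Λ (sqNorm n ^ s) := by ring
    -- An unbalanced split: `|β| = s` gives `T` itself, and `s < |γ| ≤ D - s` is reached from `s` by
    -- the growth bound.
    obtain ⟨β, hβ, hβd⟩ := Finsupp.exists_le_degree_eq α s (by omega)
    obtain ⟨γ, rfl⟩ := exists_add_of_le hβ
    rw [map_add] at *
    have hab := abs_map_monomial_add_le hΛ (β := β) (γ := γ) (by omega) (by omega) 1 1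
    have hγ := hg (γ.degree - s) (by omega)
    rw [show s + (γ.degree - s) = γ.degree by omega] at hγ
    have hγE : M ^ (γ.degree - s) ≤ M ^ E := pow_le_pow_right₀ hM (by omega)
    -- Since `s ≥ 1` and `r ≤ 1`, a plain multiple of `T` is absorbed by the term `r^(1-2s) T`.
    have hrr : 1 ≤ r / r ^ (2 * s) :=
      (one_le_div (by positivity)).2 (pow_le_of_le_one hr.le hr₁ (by omega))
    rw [hβd] at hab
    have h₁ : |Λ (MvPolynomial.monomial (β + γ) 1)| ≤ M ^ E * Λ (sqNorm n ^ s) := by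
      have := mul_le_mul_of_nonneg_right hγE hT
      have := mul_le_mul_of_nonneg_right hME hT
      linarith
    refine h₁.trans (mul_le_mul_of_nonneg_left ?_ (by positivity))
    have := mul_le_mul_of_nonneg_right hrr hT
    linarith

/-- There are at most `(n + 1)^d` monomials of degree at most `d`. -/
lemma exists_finset_degree_le (n d : ℕ) :
    ∃ S : Finset (Fin n →₀ ℕ), (∀ α, α.degree ≤ d → α ∈ S) ∧ S.card ≤ (n + 1) ^ d := by
  classical
  induction d with
  | zero =>
    refine ⟨{0}, fun α hα => ?_, by simp⟩
    simpa using (Finsupp.degree_eq_zero_iff α).1 (by omega)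
  | succ d ih =>
    obtain ⟨S, hS, hc⟩ := ih
    -- Each monomial is one of degree at most `d` times either a variable (`some i`) or 1 (`none`),
    -- whence the factor `n + 1`.
    refine ⟨(S ×ˢ (Finset.univ : Finset (Option (Fin n)))).image
      fun x => x.1 + x.2.elim 0 fun i => Finsupp.single i 1, fun α hα => ?_, ?_⟩
    · rw [Finset.mem_image]
      rcases Nat.lt_or_ge d α.degree with h | h
      · obtain ⟨γ, hγ, hγd⟩ := Finsupp.exists_le_degree_eq α d h.le
        obtain ⟨δ, rfl⟩ := exists_add_of_le hγ
        have hδ : δ.degree = 1 := by simp only [map_add] at hα h; omega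
        obtain ⟨i, rfl⟩ := (Finsupp.sum_eq_one_iff δ).1 hδ
        exact ⟨(γ, some i), by simp [hS γ hγd.le], rfl⟩
      · exact ⟨(α, none), by simp [hS α h], by simp⟩
    · refine Finset.card_image_le.trans ?_
      rw [Finset.card_product, Finset.card_univ, Fintype.card_option, Fintype.card_fin, pow_succ]
      exact Nat.mul_le_mul_right _ hc

/-- A functional is bounded by the constant term plus the contribution of the bounded moments. -/
lemma map_le_coeff_zero_add (hΛ₁ : Λ 1 = 1) {q : Poly n} {d : ℕ} (hq : q.totalDegree ≤ d)
    {c B : ℝ} (hc : ∀ α, |MvPolynomial.coeff α q| ≤ c) (hB₀ : 0 ≤ B)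
    (hB : ∀ α : Fin n →₀ ℕ, α.degree ≠ 0 → α.degree ≤ q.totalDegree →
      |Λ (MvPolynomial.monomial α 1)| ≤ B) :
    Λ q ≤ MvPolynomial.coeff 0 q + (n + 1) ^ d * (c * B) := by
  classical
  have hc₀ : 0 ≤ c := (abs_nonneg _).trans (hc 0)
  have hcard : (q.support.card : ℝ) ≤ (n + 1) ^ d := by
    obtain ⟨S, hS, hSc⟩ := exists_finset_degree_le n d
    have : q.support ⊆ S := fun α hα => hS α ((MvPolynomial.le_totalDegree hα).trans hq)
    exact_mod_cast (Finset.card_le_card this).trans hSc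
  have hsum : Λ q = ∑ α ∈ q.support,
      MvPolynomial.coeff α q * Λ (MvPolynomial.monomial α 1) := by
    conv_lhs => rw [q.as_sum, map_sum]
    refine Finset.sum_congr rfl fun α _ => ?_
    rw [← map_C_mul, MvPolynomial.C_mul_monomial, mul_one]
  have hterm : ∀ α ∈ q.support, MvPolynomial.coeff α q * Λ (MvPolynomial.monomial α 1) ≤
      (if α = 0 then MvPolynomial.coeff α q else 0) + c * B := by
    intro α hα
    split_ifs with h
    · subst h
      have : (MvPolynomial.monomial 0 1 : Poly n) = 1 := rfl
      rw [this, hΛ₁, mul_one]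
      have := mul_nonneg hc₀ hB₀
      linarith
    · rw [zero_add]
      refine (le_abs_self _).trans ?_
      rw [abs_mul]
      exact mul_le_mul (hc α) (hB α (fun h0 => h ((Finsupp.degree_eq_zero_iff α).1 h0))
        (MvPolynomial.le_totalDegree hα)) (abs_nonneg _) hc₀
  rw [hsum]
  refine (Finset.sum_le_sum hterm).trans ?_
  rw [Finset.sum_add_distrib, Finset.sum_ite_eq', Finset.sum_const, nsmul_eq_mul]
  refine add_le_add (le_of_eq ?_) (mul_le_mul_of_nonneg_right hcard (mul_nonneg hc₀ hB₀))
  split_ifs with h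
  · rfl
  · exact (MvPolynomial.notMem_support_iff.1 h).symm

end Functional

/-! ### Truncated quadratic modules and pseudo-moment sequences -/

section QuadModule

variable {n m : ℕ} {h : Fin m → Poly n}

lemma IsSos.mem_quadModule {t : ℕ} {q : Poly n} (hq : IsSos t q) : q ∈ quadModule h t :=
  ⟨q, 0, hq, fun _ => ⟨IsSumSq.zero, Or.inl rfl⟩, by simp⟩

/-- Serves to multiply the ball constraint by powers of `‖ξ - ζ‖₂²`. -/
lemma mul_mem_quadModule {a b t : ℕ} {q σ : Poly n} (hq : q ∈ quadModule h a) (hσ : IsSos b σ)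
    (hab : a + b ≤ t) : q * σ ∈ quadModule h t := by
  obtain ⟨σ₀, τ, h₀, hτ, rfl⟩ := hq
  refine ⟨σ₀ * σ, fun j => τ j * σ, IsSos.mul h₀ hσ hab,
    fun j => ⟨(hτ j).1.mul hσ.1, ?_⟩, ?_⟩
  · rcases (hτ j).2 with h0 | h0
    · exact Or.inl (by simp [h0])
    · have := MvPolynomial.totalDegree_mul (τ j) σ
      have := hσ.2
      exact Or.inr (show (h j).totalDegree + (τ j * σ).totalDegree ≤ t by omega)
  · rw [add_mul, Finset.sum_mul]
    exact congrArg _ (Finset.sum_congr rfl fun j _ => by ring)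

lemma totalDegree_le_of_mem_quadModule {t : ℕ} {q : Poly n} (hq : q ∈ quadModule h t) :
    q.totalDegree ≤ t := by
  obtain ⟨σ₀, τ, h₀, hτ, rfl⟩ := hq
  refine totalDegree_add_le_of h₀.2 (totalDegree_sum_le_of fun j _ => ?_)
  rcases (hτ j).2 with h0 | h0
  · simp [h0]
  · exact (MvPolynomial.totalDegree_mul _ _).trans h0

lemma eval_nonneg_of_mem_quadModule {t : ℕ} {q : Poly n} (hq : q ∈ quadModule h t)
    {ζ : Fin n → ℝ} (hζ : ζ ∈ feasibleSet h) : 0 ≤ MvPolynomial.eval ζ q := by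
  have key : ∀ σ : Poly n, IsSumSq σ → 0 ≤ MvPolynomial.eval ζ σ := fun σ hσ => by
    have := (IsSumSq.map_algHom (MvPolynomial.aeval ζ : Poly n →ₐ[ℝ] ℝ) hσ).nonneg
    rwa [MvPolynomial.aeval_eq_eval] at this
  obtain ⟨σ₀, τ, h₀, hτ, rfl⟩ := hq
  simp only [map_add, map_sum, map_mul]
  exact add_nonneg (key _ h₀.1)
    (Finset.sum_nonneg fun j _ => mul_nonneg (hζ j) (key _ (hτ j).1))

lemma pairing_eq_sum_of_subset {q : Poly n} {S : Finset (Fin n →₀ ℕ)} (hS : q.support ⊆ S)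
    (y : (Fin n →₀ ℕ) → ℝ) : pairing q y = ∑ α ∈ S, MvPolynomial.coeff α q * y α :=
  Finset.sum_subset hS fun α _ hα => by rw [MvPolynomial.notMem_support_iff.1 hα, zero_mul]

/-- The pairing with `y` as a linear functional. -/
noncomputable def pairingHom (y : (Fin n →₀ ℕ) → ℝ) : Poly n →ₗ[ℝ] ℝ where
  toFun q := pairing q y
  map_add' q₁ q₂ := by
    classical
    rw [pairing_eq_sum_of_subset (S := q₁.support ∪ q₂.support) MvPolynomial.support_add,
      pairing_eq_sum_of_subset (S := q₁.support ∪ q₂.support) Finset.subset_union_left,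
      pairing_eq_sum_of_subset (S := q₁.support ∪ q₂.support) Finset.subset_union_right,
      ← Finset.sum_add_distrib]
    exact Finset.sum_congr rfl fun α _ => by rw [MvPolynomial.coeff_add, add_mul]
  map_smul' c q := by
    rw [pairing_eq_sum_of_subset (S := q.support) MvPolynomial.support_smul, pairing,
      RingHom.id_apply, smul_eq_mul, Finset.mul_sum]
    exact Finset.sum_congr rfl fun α _ => by
      rw [MvPolynomial.coeff_smul, smul_eq_mul, mul_assoc]

lemma pairingHom_apply (y : (Fin n →₀ ℕ) → ℝ) (q : Poly n) : pairingHom y q = pairing q y := rfl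

lemma pairingHom_one {y : (Fin n →₀ ℕ) → ℝ} (hy : y 0 = 1) : pairingHom y 1 = 1 := by
  rw [pairingHom_apply, pairing_eq_sum_of_subset (S := {0}) (by simp)]
  simp [hy]

/-- The truncated moment sequence of the Dirac measure at `ζ`. -/
noncomputable def diracTms (t : ℕ) (ζ : Fin n → ℝ) (α : Fin n →₀ ℕ) : ℝ :=
  if α.degree ≤ t then ∏ i, ζ i ^ α i else 0

lemma pairing_diracTms {t : ℕ} {q : Poly n} (hq : q.totalDegree ≤ t) (ζ : Fin n → ℝ) :
    pairing q (diracTms t ζ) = MvPolynomial.eval ζ q := by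
  rw [MvPolynomial.eval_eq']
  refine Finset.sum_congr rfl fun α hα => ?_
  have : α.degree ≤ t := (MvPolynomial.le_totalDegree hα).trans hq
  rw [diracTms, if_pos this]

/-- Makes the pseudo-moment supremum an upper bound for pointwise values on `Ξ`, which is what weak
duality integrates. -/
lemma diracTms_mem_normalizedTms (t : ℕ) {ζ : Fin n → ℝ} (hζ : ζ ∈ feasibleSet h) :
    diracTms t ζ ∈ normalizedTms h t := by
  refine ⟨fun α hα => if_neg (by omega), by simp [diracTms], fun q hq => ?_⟩
  rw [pairing_diracTms (totalDegree_le_of_mem_quadModule hq)]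
  exact eval_nonneg_of_mem_quadModule hq hζ

/-- The functional `q ↦ ⟨q(· - ζ), y⟩` of moments centered at `ζ`. -/
noncomputable def centeredHom (y : (Fin n →₀ ℕ) → ℝ) (ζ : Fin n → ℝ) : Poly n →ₗ[ℝ] ℝ :=
  pairingHom y ∘ₗ (translateHom (-ζ)).toLinearMap

lemma centeredHom_apply (y : (Fin n →₀ ℕ) → ℝ) (ζ : Fin n → ℝ) (q : Poly n) :
    centeredHom y ζ q = pairing (translateHom (-ζ) q) y := rfl

lemma centeredHom_translate (y : (Fin n →₀ ℕ) → ℝ) (ζ : Fin n → ℝ) (q : Poly n) :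
    centeredHom y ζ (translate q ζ) = pairing q y := by
  rw [centeredHom_apply, translate_eq, translateHom_neg_translateHom]

lemma centeredHom_one {t : ℕ} {y : (Fin n →₀ ℕ) → ℝ} (hy : y ∈ normalizedTms h t)
    (ζ : Fin n → ℝ) : centeredHom y ζ 1 = 1 := by
  rw [centeredHom_apply, map_one]
  exact pairingHom_one hy.2.1

lemma centeredHom_nonneg {t : ℕ} {y : (Fin n →₀ ℕ) → ℝ} (hy : y ∈ normalizedTms h t)
    (ζ : Fin n → ℝ) {q : Poly n} (hq : IsSos t q) : 0 ≤ centeredHom y ζ q :=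
  hy.2.2 _ (hq.translateHom (-ζ)).mem_quadModule

/-- A ball constraint in the quadratic module controls the growth of the centered moments. -/
lemma centeredHom_sqNorm_pow_succ_le {t k₁ : ℕ} {R : ℝ} {y : (Fin n →₀ ℕ) → ℝ}
    (hy : y ∈ normalizedTms h t) {ζ : Fin n → ℝ} (hζ : ζ ∈ feasibleSet h)
    (hR : ballPoly n R ∈ quadModule h (2 * k₁ + 2)) {j : ℕ} (hj : 2 * k₁ + 2 + 2 * j ≤ t) :
    centeredHom y ζ (sqNorm n ^ (j + 1)) ≤ 4 * R * centeredHom y ζ (sqNorm n ^ j) := by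
  have hζR : 0 ≤ R - ∑ a, ζ a ^ 2 := by
    simpa [ballPoly] using eval_nonneg_of_mem_quadModule hR hζ
  have hσ : IsSos (2 * j) (translateHom (-ζ) (sqNorm n ^ j)) := (isSos_sqNorm_pow j).translateHom _
  have h₁ : 0 ≤ pairingHom y (ballPoly n R * translateHom (-ζ) (sqNorm n ^ j)) :=
    hy.2.2 _ (mul_mem_quadModule hR hσ hj)
  have h₂ : 0 ≤ pairingHom y (translateHom (-ζ) (sqNorm n ^ j)) :=
    hy.2.2 _ (hσ.mono (by omega)).mem_quadModule
  have h₃ : 0 ≤ pairingHom y (translateHom ζ (sqNorm n) * translateHom (-ζ) (sqNorm n ^ j)) :=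
    hy.2.2 _ ((isSos_sqNorm.translateHom ζ).mul hσ (by omega)).mem_quadModule
  -- The parallelogram law: `‖ξ-ζ‖² = 4R - [2(R-‖ξ‖²) + 2(R-‖ζ‖²) + ‖ξ+ζ‖²]`. Each bracketed term,
  -- multiplied by `‖ξ-ζ‖^(2j)`, pairs nonnegatively with `y`.
  have e₀ : translateHom (-ζ) (sqNorm n) =
      MvPolynomial.C (4 * R) - (MvPolynomial.C 2 * ballPoly n R +
        MvPolynomial.C (2 * (R - ∑ a, ζ a ^ 2)) + translateHom ζ (sqNorm n)) := by
    have : translateHom (-ζ) (sqNorm n) + translateHom ζ (sqNorm n) =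
        MvPolynomial.C 2 * ∑ a, MvPolynomial.X a ^ 2 + MvPolynomial.C (2 * ∑ a, ζ a ^ 2) := by
      simp only [sqNorm, map_sum, map_pow, translateHom_X, Pi.neg_apply, map_neg, map_mul,
        Finset.mul_sum, ← Finset.sum_add_distrib]
      exact Finset.sum_congr rfl fun a _ => by simp only [map_ofNat]; ring
    rw [← sub_eq_zero] at this ⊢
    rw [← this, ballPoly]
    simp only [map_mul, map_sub, map_ofNat]
    ring
  have e : translateHom (-ζ) (sqNorm n ^ (j + 1)) =
      MvPolynomial.C (4 * R) * translateHom (-ζ) (sqNorm n ^ j) -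
      (MvPolynomial.C 2 * (ballPoly n R * translateHom (-ζ) (sqNorm n ^ j)) +
        MvPolynomial.C (2 * (R - ∑ a, ζ a ^ 2)) * translateHom (-ζ) (sqNorm n ^ j) +
        translateHom ζ (sqNorm n) * translateHom (-ζ) (sqNorm n ^ j)) := by
    rw [pow_succ, map_mul, e₀]
    ring
  rw [centeredHom_apply, centeredHom_apply, ← pairingHom_apply, ← pairingHom_apply, e, map_sub,
    map_add, map_add, map_C_mul, map_C_mul, map_C_mul]
  have := mul_nonneg hζR h₂
  linarith

end QuadModule

/-! ### Slices of the cost polynomial -/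

section Slice

variable {n₁ n₀ : ℕ}

lemma totalDegree_slice_le (F : MvPolynomial (Fin n₁ ⊕ Fin n₀) ℝ) (x : Fin n₁ → ℝ) :
    (slice F x).totalDegree ≤ F.totalDegree := by
  rw [slice, MvPolynomial.aeval_def, MvPolynomial.eval₂_eq]
  refine totalDegree_sum_le_of fun α hα => ?_
  refine (totalDegree_C_mul_le_of _ ?_).trans (MvPolynomial.le_totalDegree hα)
  refine (MvPolynomial.totalDegree_finsetProd _ _).trans (Finset.sum_le_sum fun i _ => ?_)
  refine (totalDegree_pow_le_of (a := 1) ?_ _).trans (by simp)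
  rcases i with i | i
  · simp
  · exact (MvPolynomial.totalDegree_X i).le

lemma totalDegree_slice_le_sliceDegree (F : MvPolynomial (Fin n₁ ⊕ Fin n₀) ℝ)
    {X : Set (Fin n₁ → ℝ)} {x : Fin n₁ → ℝ} (hx : x ∈ X) :
    (slice F x).totalDegree ≤ sliceDegree F X := by
  refine le_csSup ⟨F.totalDegree, ?_⟩ ⟨x, hx, rfl⟩
  rintro d ⟨z, _, rfl⟩
  exact totalDegree_slice_le F z

/-- Guarantees that the real `sSup` in `coeffBound` is a genuine supremum and not the default value
0 of an unbounded set. -/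
lemma exists_abs_coeff_translate_slice_le (F : MvPolynomial (Fin n₁ ⊕ Fin n₀) ℝ)
    {X : Set (Fin n₁ → ℝ)} {K : Set (Fin n₀ → ℝ)} (hX : Bornology.IsBounded X)
    (hK : Bornology.IsBounded K) :
    ∃ B, ∀ x ∈ X, ∀ ζ ∈ K, ∀ α, |MvPolynomial.coeff α (translate (slice F x) ζ)| ≤ B := by
  classical
  obtain ⟨a, ha⟩ := hX.exists_norm_le
  obtain ⟨b, hb⟩ := hK.exists_norm_le
  induction F using MvPolynomial.induction_on with
  | C c =>
    refine ⟨|c|, fun x _ ζ _ α => ?_⟩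
    have : translate (slice (MvPolynomial.C c) x) ζ = MvPolynomial.C c := by
      simp [slice, translate_eq, MvPolynomial.algebraMap_eq]
    rw [this, MvPolynomial.coeff_C]
    split_ifs <;> simp
  | add p q hp hq =>
    obtain ⟨B, hB⟩ := hp
    obtain ⟨B', hB'⟩ := hq
    refine ⟨B + B', fun x hx ζ hζ α => ?_⟩
    have : translate (slice (p + q) x) ζ = translate (slice p x) ζ + translate (slice q x) ζ := by
      simp [slice, translate_eq]
    rw [this, MvPolynomial.coeff_add]
    exact (abs_add_le _ _).trans (add_le_add (hB x hx ζ hζ α) (hB' x hx ζ hζ α))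
  | mul_X p i hp =>
    obtain ⟨B, hB⟩ := hp
    rcases i with i | i
    · refine ⟨B * a, fun x hx ζ hζ α => ?_⟩
      have : translate (slice (p * MvPolynomial.X (Sum.inl i)) x) ζ =
          translate (slice p x) ζ * MvPolynomial.C (x i) := by
        simp [slice, translate_eq]
      rw [this, mul_comm _ (MvPolynomial.C _), MvPolynomial.coeff_C_mul, mul_comm, abs_mul]
      exact mul_le_mul (hB x hx ζ hζ α) ((norm_le_pi_norm x i).trans (ha x hx)) (abs_nonneg _)
        ((abs_nonneg _).trans (hB x hx ζ hζ α))
    · refine ⟨B + B * b, fun x hx ζ hζ α => ?_⟩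
      have : translate (slice (p * MvPolynomial.X (Sum.inr i)) x) ζ =
          translate (slice p x) ζ * MvPolynomial.X i +
            translate (slice p x) ζ * MvPolynomial.C (ζ i) := by
        simp [slice, translate_eq, mul_add]
      have hB₀ : 0 ≤ B := (abs_nonneg _).trans (hB x hx ζ hζ α)
      rw [this, MvPolynomial.coeff_add]
      refine (abs_add_le _ _).trans (add_le_add ?_ ?_)
      · rw [MvPolynomial.coeff_mul_X']
        split_ifs
        · exact hB x hx ζ hζ _
        · simpa using hB₀
      · rw [mul_comm _ (MvPolynomial.C _), MvPolynomial.coeff_C_mul, mul_comm, abs_mul]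
        exact mul_le_mul (hB x hx ζ hζ α) ((norm_le_pi_norm ζ i).trans (hb ζ hζ)) (abs_nonneg _)
          hB₀

lemma abs_coeff_translate_slice_le_coeffBound (F : MvPolynomial (Fin n₁ ⊕ Fin n₀) ℝ)
    {X : Set (Fin n₁ → ℝ)} {K : Set (Fin n₀ → ℝ)} (hX : Bornology.IsBounded X)
    (hK : Bornology.IsBounded K) {x : Fin n₁ → ℝ} (hx : x ∈ X) {ζ : Fin n₀ → ℝ} (hζ : ζ ∈ K)
    (α : Fin n₀ →₀ ℕ) :
    |MvPolynomial.coeff α (translate (slice F x) ζ)| ≤ coeffBound F X K := by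
  obtain ⟨B, hB⟩ := exists_abs_coeff_translate_slice_le F hX hK
  refine le_csSup ⟨B, ?_⟩ ⟨x, hx, ζ, hζ, α, rfl⟩
  rintro c ⟨x, hx, ζ, hζ, α, rfl⟩
  exact hB x hx ζ hζ α

end Slice

/-! ### Comparison of the worst-case mean, its relaxation and the empirical mean -/

section Means

variable {n₁ n₀ m N : ℕ} {H : Matrix (Fin n₀) (Fin n₀) ℝ} {p k : ℕ} {h : Fin m → Poly n₀}
  {F : MvPolynomial (Fin n₁ ⊕ Fin n₀) ℝ} {ξhat : Fin N → Fin n₀ → ℝ} {x : Fin n₁ → ℝ}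

lemma coe_sum_ereal {ι : Type*} (I : Finset ι) (u : ι → ℝ) :
    ((∑ i ∈ I, u i : ℝ) : EReal) = ∑ i ∈ I, (u i : EReal) :=
  map_sum (⟨⟨Real.toEReal, EReal.coe_zero⟩, EReal.coe_add⟩ : ℝ →+ EReal) u I

lemma eval_distPoly_self (hp : 1 < p) (ζ : Fin n₀ → ℝ) :
    MvPolynomial.eval ζ (distPoly H p ζ) = 0 := by
  have : p / 2 ≠ 0 := by omega
  simp [distPoly, this]

/-- The Dirac measures at the samples are feasible. -/
lemma empiricalMean_le_worstCaseMean (hp : 1 < p) (hξ : ∀ i, ξhat i ∈ feasibleSet h) {ρ : ℝ}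
    (hρ : 0 ≤ ρ) : (empiricalMean F ξhat x : EReal) ≤ worstCaseMean H p h F ξhat x ρ := by
  have hint : ∀ (q : Poly n₀) (ζ : Fin n₀ → ℝ),
      Integrable (fun ξ => MvPolynomial.eval ξ q) (Measure.dirac ζ) := fun q ζ =>
    integrable_dirac (by simp)
  refine le_trans (le_of_eq ?_) (le_iSup₂_of_le (fun i => Measure.dirac (ξhat i)) ?_ le_rfl)
  · simp [empiricalMean]
  · refine ⟨fun i => ⟨inferInstance, ?_, hint _ _, hint _ _⟩, ?_⟩
    · rw [ae_dirac_eq]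
      exact hξ i
    · simpa [eval_distPoly_self hp] using hρ

/-- Weak duality. -/
lemma worstCaseMean_le_relaxedMean (hFk : (slice F x).totalDegree ≤ 2 * k) (hpk : p / 2 ≤ k)
    {ρ : ℝ} : worstCaseMean H p h F ξhat x ρ ≤ relaxedMean H p k h F ξhat x ρ := by
  refine iSup₂_le fun μ hμ => le_iInf₂ fun l hl => ?_
  obtain ⟨hμ, hρ⟩ := hμ
  have hl : 0 ≤ l := hl
  set I : Fin N → ℝ := fun i => ∫ ξ, MvPolynomial.eval ξ
    (slice F x - MvPolynomial.C l * distPoly H p (ξhat i)) ∂(μ i) with hI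
  have hIeq : ∀ i, I i = ∫ ξ, MvPolynomial.eval ξ (slice F x) ∂(μ i) -
      l * ∫ ξ, MvPolynomial.eval ξ (distPoly H p (ξhat i)) ∂(μ i) := fun i => by
    simp only [hI, map_sub, map_mul, MvPolynomial.eval_C]
    rw [integral_sub (hμ i).2.2.2 ((hμ i).2.2.1.const_mul l), integral_const_mul]
  have hIle : ∀ i, (I i : EReal) ≤ ⨆ y ∈ normalizedTms h (2 * k),
      ((pairing (slice F x - MvPolynomial.C l * distPoly H p (ξhat i)) y : ℝ) : EReal) := by
    intro i
    have := (hμ i).1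
    set q := slice F x - MvPolynomial.C l * distPoly H p (ξhat i)
    have hq : q.totalDegree ≤ 2 * k := totalDegree_sub_le_of hFk
      (totalDegree_C_mul_le_of _ ((totalDegree_distPoly_le H (ξhat i)).trans (by omega)))
    -- The supremum may be `⊤`, so it is replaced by an arbitrary real `z` above it; such a `z`
    -- bounds the polynomial on `Ξ` and can be integrated.
    refine EReal.le_of_forall_lt_iff_le.1 fun z hz => ?_
    have hz' : ∀ ξ ∈ feasibleSet h, MvPolynomial.eval ξ q ≤ z := fun ξ hξ => by
      have := (le_iSup₂ (f := fun y (_ : y ∈ normalizedTms h (2 * k)) => ((pairing q y : ℝ) : EReal))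
        _ (diracTms_mem_normalizedTms (2 * k) hξ)).trans hz.le
      rw [pairing_diracTms hq] at this
      exact_mod_cast this
    have hint : Integrable (fun ξ => MvPolynomial.eval ξ q) (μ i) := by
      have := (hμ i).2.2.2.sub ((hμ i).2.2.1.const_mul l)
      refine this.congr (ae_of_all _ fun ξ => ?_)
      simp [q]
    have : I i ≤ ∫ _, z ∂(μ i) :=
      integral_mono_ae hint (integrable_const z) ((hμ i).2.1.mono fun ξ hξ => hz' ξ hξ)
    have : I i ≤ z := by simpa using this
    exact_mod_cast this
  have hsum : ((∑ i, I i : ℝ) : EReal) ≤ ∑ i, ⨆ y ∈ normalizedTms h (2 * k),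
      ((pairing (slice F x - MvPolynomial.C l * distPoly H p (ξhat i)) y : ℝ) : EReal) := by
    rw [coe_sum_ereal]
    exact Finset.sum_le_sum fun i _ => hIle i
  have hN : (0 : EReal) ≤ (((N : ℝ)⁻¹ : ℝ) : EReal) := by
    exact_mod_cast (by positivity : (0 : ℝ) ≤ (N : ℝ)⁻¹)
  refine le_trans ?_ (add_le_add le_rfl (mul_le_mul_of_nonneg_left hsum hN))
  rw [← EReal.coe_mul, ← EReal.coe_add, EReal.coe_le_coe_iff]
  simp only [hIeq, Finset.sum_sub_distrib, ← Finset.mul_sum]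
  have := mul_le_mul_of_nonneg_left hρ hl
  linarith

/-- A uniform bound for the pseudo-moment problems bounds the relaxation. -/
lemma relaxedMean_le_of_forall_pairing_le (hN : 0 < N) {l b ρ : ℝ} (hl : 0 ≤ l)
    (hb : ∀ i, ∀ y ∈ normalizedTms h (2 * k),
      pairing (slice F x - MvPolynomial.C l * distPoly H p (ξhat i)) y ≤
        MvPolynomial.eval (ξhat i) (slice F x) + b) :
    relaxedMean H p k h F ξhat x ρ ≤ ((empiricalMean F ξhat x + (l * ρ + b) : ℝ) : EReal) := by
  refine (iInf₂_le l hl).trans ?_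
  have hsum : (∑ i, ⨆ y ∈ normalizedTms h (2 * k),
      ((pairing (slice F x - MvPolynomial.C l * distPoly H p (ξhat i)) y : ℝ) : EReal)) ≤
      ((∑ i, (MvPolynomial.eval (ξhat i) (slice F x) + b) : ℝ) : EReal) := by
    rw [coe_sum_ereal]
    exact Finset.sum_le_sum fun i _ => iSup₂_le fun y hy => EReal.coe_le_coe_iff.2 (hb i y hy)
  have hN' : (0 : EReal) ≤ (((N : ℝ)⁻¹ : ℝ) : EReal) := by
    exact_mod_cast (by positivity : (0 : ℝ) ≤ (N : ℝ)⁻¹)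
  refine (add_le_add le_rfl (mul_le_mul_of_nonneg_left hsum hN')).trans (le_of_eq ?_)
  rw [← EReal.coe_mul, ← EReal.coe_add, EReal.coe_eq_coe_iff, Finset.sum_add_distrib,
    empiricalMean]
  simp only [Finset.sum_const, Finset.card_univ, Fintype.card_fin, nsmul_eq_mul]
  field_simp
  ring

/-- The pseudo-moment problem at one sample, with the multiplier chosen at scale `r`. -/
lemma pairing_slice_sub_le {X : Set (Fin n₁ → ℝ)} {K : Set (Fin n₀ → ℝ)} {θ R : ℝ} {k₁ : ℕ}
    (hp : Even p) (hp₁ : 1 < p) (hθ : 0 < θ) (hH : H.PosDef)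
    (hHθ : ∀ v : Fin n₀ → ℝ, θ * (v ⬝ᵥ v) ≤ v ⬝ᵥ H.mulVec v) (hX : Bornology.IsBounded X)
    (hk : lowestOrder F X h p ≤ k)
    (hcase : sliceDegree F X ≤ p ∨
      (ballPoly n₀ R ∈ quadModule h (2 * k₁ + 2) ∧ sliceDegree F X + k₁ ≤ k + p / 2))
    (hKh : K ⊆ feasibleSet h) (hK : Bornology.IsBounded K) (hx : x ∈ X) {ζ : Fin n₀ → ℝ}
    (hζ : ζ ∈ K) {r : ℝ} (hr : 0 < r) (hr₁ : r ≤ 1) {y : (Fin n₀ →₀ ℕ) → ℝ}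
    (hy : y ∈ normalizedTms h (2 * k)) :
    pairing (slice F x - MvPolynomial.C ((n₀ + 1) ^ (2 * k) * coeffBound F X K *
        max 1 (4 * R) ^ (2 * k) / θ ^ (p / 2) * (r / r ^ p)) * distPoly H p ζ) y ≤
      MvPolynomial.eval ζ (slice F x) +
        (n₀ + 1) ^ (2 * k) * coeffBound F X K * max 1 (4 * R) ^ (2 * k) * r := by
  have hcoeff := abs_coeff_translate_slice_le_coeffBound F hX hK hx hζ
  set c := coeffBound F X K
  set M := max 1 (4 * R)
  set s := p / 2 with hs
  have hps : p = 2 * s := by obtain ⟨a, rfl⟩ := hp; omega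
  have hdeg : (slice F x).totalDegree ≤ sliceDegree F X := totalDegree_slice_le_sliceDegree F hx
  simp only [lowestOrder, max_le_iff] at hk
  have hc : 0 ≤ c := (abs_nonneg _).trans (hcoeff 0)
  have hM : 1 ≤ M := le_max_left _ _
  have hΛ : ∀ q, IsSos (2 * k) q → 0 ≤ centeredHom y ζ q := fun q => centeredHom_nonneg hy ζ
  have hΛ₁ := centeredHom_one hy ζ
  set T := centeredHom y ζ (sqNorm n₀ ^ s) with hTdef
  have hT : 0 ≤ T := hΛ _ ((isSos_sqNorm_pow s).mono (by omega))
  have htd : (translate (slice F x) ζ).totalDegree ≤ sliceDegree F X :=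
    (totalDegree_translateHom_le ζ _).trans hdeg
  have hF : pairing (slice F x) y ≤ MvPolynomial.eval ζ (slice F x) +
      (n₀ + 1) ^ (2 * k) * (c * (M ^ (2 * k) * (r + r / r ^ (2 * s) * T))) := by
    rw [← centeredHom_translate y ζ, eval_eq_coeff_zero_translate]
    refine map_le_coeff_zero_add hΛ₁ (htd.trans (by omega)) hcoeff (by positivity)
      fun α hα hαd => ?_
    refine abs_map_monomial_le hΛ hΛ₁ (D := sliceDegree F X) (by omega) (by omega) hr hr₁ hM
      (by omega) ?_ hα (hαd.trans htd)
    -- The largest `j` is `D - s - 1` with `D` the slice degree; there the degree requirement `2k₁ +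
    -- 2 + 2j ≤ 2k` is exactly `D + k₁ ≤ k + s`.
    refine hcase.imp (fun hD => by omega) fun ⟨hball, hD⟩ => ⟨by omega, fun j hj => ?_⟩
    refine (centeredHom_sqNorm_pow_succ_le hy (hKh hζ) hball (by omega)).trans ?_
    exact mul_le_mul_of_nonneg_right (le_max_right _ _)
      (hΛ _ ((isSos_sqNorm_pow j).mono (by omega)))
  have hQ : θ ^ s * T ≤ pairing (distPoly H p ζ) y := by
    have := hΛ _ ((isSos_quadForm_pow_sub hH.isHermitian hθ.le hHθ s).mono (by omega))
    rw [map_sub, map_C_mul, centeredHom_apply y ζ (quadForm H ^ s), hs,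
      ← distPoly_eq_translateHom] at this
    linarith
  rw [← pairingHom_apply, map_sub, map_C_mul, pairingHom_apply, pairingHom_apply]
  have hθs : 0 < θ ^ s := by positivity
  have hl : 0 ≤ (n₀ + 1) ^ (2 * k) * c * M ^ (2 * k) / θ ^ s * (r / r ^ p) := by positivity
  have hlQ := mul_le_mul_of_nonneg_left hQ hl
  -- The division by `θ^s` in the multiplier is chosen so that the penalty cancels the `T` term of
  -- `hF` exactly.
  have e : (n₀ + 1) ^ (2 * k) * c * M ^ (2 * k) / θ ^ s * (r / r ^ p) * (θ ^ s * T) =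
      (n₀ + 1) ^ (2 * k) * c * M ^ (2 * k) * (r / r ^ p) * T := by
    field_simp
  rw [e] at hlQ
  rw [← hps] at hF
  have e' : ((n₀ : ℝ) + 1) ^ (2 * k) * (c * (M ^ (2 * k) * (r + r / r ^ p * T))) =
      (n₀ + 1) ^ (2 * k) * c * M ^ (2 * k) * r +
        (n₀ + 1) ^ (2 * k) * c * M ^ (2 * k) * (r / r ^ p) * T := by ring
  rw [e'] at hF
  linarith

end Means

end MomentDRO

/-! ### The squeeze around the empirical mean. -/

theorem mainTheorem1 (p k : ℕ) (hp : Even p) (hp1 : 1 < p)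
    (θ : ℝ) (hθ : 0 < θ) (R : ℝ) (hR : 0 < R) (k₁ : ℕ) :
    -- the polynomial `P` and `r₀` depend only on `p`, `k`, `θ`, `R`, `k₁`
    ∃ (P : Polynomial ℝ) (r₀ : ℝ), 0 < r₀ ∧
      ∀ (n₀ n₁ m₁ : ℕ) (H : Matrix (Fin n₀) (Fin n₀) ℝ) (h : Fin m₁ → MomentDRO.Poly n₀)
        (X : Set (Fin n₁ → ℝ)) (f : (Fin n₁ → ℝ) → ℝ)
        (F : MvPolynomial (Fin n₁ ⊕ Fin n₀) ℝ) (K : Set (Fin n₀ → ℝ)),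
      H.PosDef →
      -- every eigenvalue of `H` is at least `θ`
      (∀ v : Fin n₀ → ℝ, θ * (v ⬝ᵥ v) ≤ v ⬝ᵥ H.mulVec v) →
      (interior (MomentDRO.feasibleSet h)).Nonempty →
      Bornology.IsBounded X →
      MomentDRO.lowestOrder F X h p ≤ k →
      (MomentDRO.sliceDegree F X ≤ p ∨
        (MomentDRO.ballPoly n₀ R ∈ MomentDRO.quadModule h (2 * k₁ + 2) ∧
          MomentDRO.sliceDegree F X + k₁ ≤ k + p / 2)) →
      -- the samples are taken from an arbitrary bounded part `K` of the support
      K ⊆ MomentDRO.feasibleSet h → Bornology.IsBounded K →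
      ∀ (N : ℕ) (ξhat : Fin N → Fin n₀ → ℝ), 0 < N → (∀ i, ξhat i ∈ K) →
      ∀ r : ℝ, 0 < r → r ≤ r₀ →
        (∀ x ∈ X,
          MomentDRO.worstCaseMean H p h F ξhat x (r ^ p) ≠ ⊥ ∧
          MomentDRO.relaxedMean H p k h F ξhat x (r ^ p) ≠ ⊤ ∧
          MomentDRO.worstCaseMean H p h F ξhat x (r ^ p) ≤
            MomentDRO.relaxedMean H p k h F ξhat x (r ^ p) ∧
          MomentDRO.relaxedMean H p k h F ξhat x (r ^ p) -
              MomentDRO.worstCaseMean H p h F ξhat x (r ^ p) ≤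
            ((P.eval (n₀ : ℝ) * MomentDRO.coeffBound F X K * r : ℝ) : EReal)) ∧
        (∀ xbar ∈ X,
          IsMinOn (fun x => (f x : EReal) +
            MomentDRO.relaxedMean H p k h F ξhat x (r ^ p)) X xbar →
          ∀ x ∈ X,
            f xbar + MomentDRO.empiricalMean F ξhat xbar ≤
              f x + MomentDRO.empiricalMean F ξhat x +
                P.eval (n₀ : ℝ) * MomentDRO.coeffBound F X K * r) := by
  -- In the factor `1 + θ^(-p/2)`, the 1 comes from the moment bound and `θ^(-p/2)` from the cost `l
  -- * r^p` of the multiplier. The choice `r₀ = 1` is what makes `r^|α| ≤ r` for nonconstant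
  -- monomials.
  refine ⟨Polynomial.C (max 1 (4 * R) ^ (2 * k) * (1 + (θ ^ (p / 2))⁻¹)) *
    (Polynomial.X + 1) ^ (2 * k), 1, one_pos, ?_⟩
  intro n₀ n₁ m₁ H h X f F K hH hHθ _ hX hk hcase hKh hK N ξhat hN hξ r hr hr₁
  have hP : (Polynomial.C (max 1 (4 * R) ^ (2 * k) * (1 + (θ ^ (p / 2))⁻¹)) *
      (Polynomial.X + 1) ^ (2 * k)).eval (n₀ : ℝ) =
      max 1 (4 * R) ^ (2 * k) * (1 + (θ ^ (p / 2))⁻¹) * (n₀ + 1) ^ (2 * k) := by simp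
  rw [hP]
  set C := max 1 (4 * R) ^ (2 * k) * (1 + (θ ^ (p / 2))⁻¹) * ((n₀ : ℝ) + 1) ^ (2 * k) *
    MomentDRO.coeffBound F X K * r with hC
  have hk' := hk
  simp only [MomentDRO.lowestOrder, max_le_iff] at hk'
  have hlow : ∀ x, (MomentDRO.empiricalMean F ξhat x : EReal) ≤
      MomentDRO.worstCaseMean H p h F ξhat x (r ^ p) := fun x =>
    MomentDRO.empiricalMean_le_worstCaseMean hp1 (fun i => hKh (hξ i)) (by positivity)
  have hdual : ∀ x ∈ X, MomentDRO.worstCaseMean H p h F ξhat x (r ^ p) ≤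
      MomentDRO.relaxedMean H p k h F ξhat x (r ^ p) := fun x hx =>
    MomentDRO.worstCaseMean_le_relaxedMean
      ((MomentDRO.totalDegree_slice_le_sliceDegree F hx).trans (by omega)) hk'.2
  have hup : ∀ x ∈ X, MomentDRO.relaxedMean H p k h F ξhat x (r ^ p) ≤
      ((MomentDRO.empiricalMean F ξhat x + C : ℝ) : EReal) := by
    intro x hx
    have hc : 0 ≤ MomentDRO.coeffBound F X K := (abs_nonneg _).trans
      (MomentDRO.abs_coeff_translate_slice_le_coeffBound F hX hK hx (hξ ⟨0, hN⟩) 0)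
    refine (MomentDRO.relaxedMean_le_of_forall_pairing_le hN (by positivity)
      fun i y hy => MomentDRO.pairing_slice_sub_le hp hp1 hθ hH hHθ hX hk hcase hKh hK hx (hξ i)
        hr hr₁ hy).trans (le_of_eq ?_)
    rw [EReal.coe_eq_coe_iff, hC]
    field_simp
    ring
  refine ⟨fun x hx => ⟨?_, ?_, hdual x hx, ?_⟩, fun xbar hxbar hmin x hx => ?_⟩
  · exact ne_bot_of_le_ne_bot (EReal.coe_ne_bot _) (hlow x)
  · exact ne_top_of_le_ne_top (EReal.coe_ne_top _) (hup x hx)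
  · refine (EReal.sub_le_sub (hup x hx) (hlow x)).trans (le_of_eq ?_)
    rw [← EReal.coe_sub, add_sub_cancel_left]
  · have h₁ : (f xbar : EReal) + MomentDRO.empiricalMean F ξhat xbar ≤
        f xbar + MomentDRO.relaxedMean H p k h F ξhat xbar (r ^ p) :=
      add_le_add le_rfl ((hlow xbar).trans (hdual xbar hxbar))
    have h₂ := (h₁.trans (hmin hx)).trans (add_le_add le_rfl (hup x hx))
    rw [← EReal.coe_add, ← EReal.coe_add, EReal.coe_le_coe_iff] at h₂
    linarith
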